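/- Let $\mathcal A\subset\mathbb C$ be a finite modulation constellation of zero mean, $\sum_{x\in\mathcal A}x=0$ (in particular any constellation symmetric about the origin), with average symbol energy $E=\frac1{|\mathcal A|}\sum_{x\in\mathcal A}|x|^2>0$. Let $\beta>0$, let $s=\sqrt{\beta E}$, and let $\bar{\mathcal A}=\{x+s: x\in\mathcal A\}$ be the shifted constellation. Let $N\ge1$ and $\sigma>0$. Node $a$ observes $$y_{i}=h_{aa}\,\bar x_{a,i}+h_{ba}\,\bar x_{b,i}+w_{i},\qquad i=1,\dots,N,$$ where $h_{aa},h_{ba}\in\mathbb C$ are unknown deterministic channel gains, the symbols $\bar x_{a,i}$ and $\bar x_{b,i}$ are uniformly distributed on $\bar{\mathcal A}$, the noise samples $w_{i}$ have the circularly symmetric complex Gaussian law $\mathcal{CN}(0,\sigma^2)$, and all $3N$ of these random variables are independent. Let $\phi=(\operatorname{Re}h_{aa},\operatorname{Im}h_{aa},\operatorname{Re}h_{ba},\operatorname{Im}h_{ba})$ and let $\hat\phi=\hat\phi(\bar{\mathbf x}_a,\mathbf y)\in\mathbb R^4$ be an estimator of $\phi$ from the known own symbols $\bar{\mathbf x}_a$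 and the observations $\mathbf y$ that is unbiased: $\mathbb E[\hat\phi]=\phi$ for all $h_{aa},h_{ba}\in\mathbb C$. Then, for all $h_{aa},h_{ba}\in\mathbb C$ and each $l\in\{1,2,3,4\}$, $$\mathbb E\big[|\hat\phi_l-\phi_l|^2\big]\;\ge\;\frac{\sigma^2}{2NE}\cdot\frac{1+\beta}{1+2\beta},$$ where expectations are over the symbols of both nodes and the noise (the left side may be $+\infty$). -/

import Mathlib

open MeasureTheory ProbabilityTheory

noncomputable section

namespace FullDuplex

/-- The average symbol energy `(∑ |x_k|²) / M` of a constellation of `M` points. -/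
def avgEnergy (A : Finset ℂ) : ℝ := (∑ x ∈ A, ‖x‖ ^ 2) / (A.card : ℝ)

/-- The constellation `{x_k + s}` obtained by shifting `A` by the real constant `s`. -/
def shifted (A : Finset ℂ) (s : ℝ) : Finset ℂ := A.image fun x => x + (s : ℂ)

/-- The circularly symmetric complex Gaussian law `𝒞𝒩(0, v)`: independent real and imaginary parts,
each real Gaussian with mean `0` and variance `v / 2`. -/
def complexGaussian (v : ℝ) : Measure ℂ :=
  ((gaussianReal 0 (v / 2).toNNReal).prod (gaussianReal 0 (v / 2).toNNReal)).map
    fun p => (p.1 : ℂ) + (p.2 : ℂ) * Complex.I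

/-- The probabilistic assumptions on one frame of length `N`: the symbols `Xa i`, `Xb i` transmitted
by the two nodes are equiprobable points of the constellation `B`, the noise samples `W i` have law
`𝒞𝒩(0, σ²)`, and all these `3 N` random variables are independent. -/
structure IsFrame {Ω : Type*} [MeasurableSpace Ω] (P : Measure Ω) {N : ℕ} (B : Finset ℂ) (σ : ℝ)
    (Xa Xb W : Fin N → Ω → ℂ) : Prop where
  law_Xa : ∀ i, HasLaw (Xa i) (uniformOn (B : Set ℂ)) P
  law_Xb : ∀ i, HasLaw (Xb i) (uniformOn (B : Set ℂ)) P
  law_W : ∀ i, HasLaw (W i) (complexGaussian (σ ^ 2)) P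
  indep : iIndepFun (Sum.elim Xa (Sum.elim Xb W)) P

/-- The observation vector `y_a = h_aa x_a + h_ba x_b + w_a`. -/
def received {Ω : Type*} {N : ℕ} (Xa Xb W : Fin N → Ω → ℂ) (haa hba : ℂ) (ω : Ω) : Fin N → ℂ :=
  fun i => haa * Xa i ω + hba * Xb i ω + W i ω

/-- The real parameter vector `φ = (Re h_aa, Im h_aa, Re h_ba, Im h_ba)`. -/
def param (haa hba : ℂ) : Fin 4 → ℝ := ![haa.re, haa.im, hba.re, hba.im]

/-- The value of an estimator at the data available at node `a`: its own symbols `x_a` and the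
observations `y_a`. -/
def estimate {Ω : Type*} {N : ℕ} (est : (Fin N → ℂ) → (Fin N → ℂ) → Fin 4 → ℝ)
    (Xa Xb W : Fin N → Ω → ℂ) (haa hba : ℂ) (ω : Ω) : Fin 4 → ℝ :=
  est (fun i => Xa i ω) (received Xa Xb W haa hba ω)

/-- An estimator of `φ` is unbiased if its expectation exists and equals `φ`, whatever the unknown
channel gains are. The expectation is over transmitted symbols and noise. -/
def IsUnbiased {Ω : Type*} [MeasurableSpace Ω] (P : Measure Ω) {N : ℕ}
    (est : (Fin N → ℂ) → (Fin N → ℂ) → Fin 4 → ℝ) (Xa Xb W : Fin N → Ω → ℂ) : Prop :=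
  ∀ (haa hba : ℂ) (l : Fin 4),
    Integrable (fun ω => estimate est Xa Xb W haa hba ω l) P ∧
      ∫ ω, estimate est Xa Xb W haa hba ω l ∂P = param haa hba l

/-- The mean square error of the `l`-th component of an estimator (possibly infinite). -/
def mse {Ω : Type*} [MeasurableSpace Ω] (P : Measure Ω) {N : ℕ}
    (est : (Fin N → ℂ) → (Fin N → ℂ) → Fin 4 → ℝ) (Xa Xb W : Fin N → Ω → ℂ) (haa hba : ℂ)
    (l : Fin 4) : ENNReal :=
  ∫⁻ ω, ENNReal.ofReal (|estimate est Xa Xb W haa hba ω l - param haa hba l| ^ 2) ∂P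

end FullDuplex

end

/-! This is a Cramér–Rao bound, obtained as a limit of Hammersley–Chapman–Robbins inequalities, so
the estimator needs no smoothness in the gains. Moving the gains by `t * (da, db)` has the same
effect on the data as translating the noise by `t * (da * x_a + db * x_b)`
(`IsFrame.integral_statistic_shift`). On the joint space of all symbols and noise, this translation
has an explicit Gaussian likelihood ratio `L` (`prod_noiseLaw_map_shift`). The unknown symbols `x_b`
therefore need not be averaged out: the bound holds even for an estimator that sees them.

Unbiasedness fixes the mean of the estimator under every translation, and the second moment of `L`
is an exponential moment of the energy of the shift. Letting `t → 0` turns this into the information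
term `2 / v * ∫ ∑ ‖c‖ ^ 2` (`two_mul_sub_fisher_le`).

For real and imaginary parts separately, the information matrix is `2 N E / σ ^ 2` times `[[1 + β,
β], [β, 1 + β]]`. The off-diagonal entry comes from the nonzero mean of the shifted symbols. The
diagonal of the inverse is the stated bound, and it is reached by perturbing along a column of the
inverse (`exists_direction`). -/

noncomputable section

namespace FullDuplex

open scoped NNReal ENNReal

/-! ### Likelihood ratios of translated Gaussian vectors. -/

section PiDensity

variable {ι : Type*} [Fintype ι] {X : ι → Type*} [∀ i, MeasurableSpace (X i)]

lemma pi_withDensity (μ : ∀ i, Measure (X i)) [∀ i, IsProbabilityMeasure (μ i)]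
    (f : ∀ i, X i → ℝ≥0∞) (hf : ∀ i, Measurable (f i))
    [∀ i, SigmaFinite ((μ i).withDensity (f i))] :
    Measure.pi (fun i => (μ i).withDensity (f i)) =
      (Measure.pi μ).withDensity (fun x => ∏ i, f i (x i)) := by
  refine (Measure.pi_eq fun s hs => ?_)
  rw [withDensity_apply _ (MeasurableSet.univ_pi hs), ← lintegral_indicator (MeasurableSet.univ_pi hs)]
  have h : (Set.univ.pi s).indicator (fun x : ∀ i, X i => ∏ i, f i (x i)) =
      fun x => ∏ i, (s i).indicator (f i) (x i) := by
    funext x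
    by_cases hx : x ∈ Set.univ.pi s
    · rw [Set.indicator_of_mem hx]
      exact Finset.prod_congr rfl fun i _ => (Set.indicator_of_mem (hx i trivial) _).symm
    · rw [Set.indicator_of_notMem hx]
      simp only [Set.mem_pi, Set.mem_univ, true_implies, not_forall] at hx
      obtain ⟨i, hi⟩ := hx
      exact (Finset.prod_eq_zero (Finset.mem_univ i) (Set.indicator_of_notMem hi _)).symm
  rw [h]
  -- Coordinates are independent under the product measure, so the integral of the product factors.
  refine (lintegral_prod_eq_prod_lintegral_of_indepFun Finset.univ
    (fun i (x : ∀ i, X i) => (s i).indicator (f i) (x i)) ?_ ?_).trans ?_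
  · exact iIndepFun_pi fun i => ((hf i).indicator (hs i)).aemeasurable
  · exact fun i => ((hf i).indicator (hs i)).comp (measurable_pi_apply i)
  · refine Finset.prod_congr rfl fun i _ => ?_
    rw [withDensity_apply _ (hs i), ← lintegral_indicator (hs i)]
    exact (measurePreserving_eval μ i).lintegral_comp ((hf i).indicator (hs i))

end PiDensity

lemma gaussianReal_map_add_eq_withDensity {v : ℝ} (hv : 0 < v) (a : ℝ) :
    (gaussianReal 0 (v / 2).toNNReal).map (· + a) =
      (gaussianReal 0 (v / 2).toNNReal).withDensity
        (fun x => ENNReal.ofReal (Real.exp ((2 * a * x - a ^ 2) / v))) := by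
  have hv' : (v / 2).toNNReal ≠ 0 := by simpa using hv
  have hc : ((v / 2).toNNReal : ℝ) = v / 2 := Real.coe_toNNReal _ (by positivity)
  rw [gaussianReal_map_add_const, gaussianReal_of_var_ne_zero _ hv', gaussianReal_of_var_ne_zero _ hv',
    ← withDensity_mul _ (measurable_gaussianPDF _ _) (by fun_prop)]
  congr 1
  funext x
  simp only [Pi.mul_apply, gaussianPDF, gaussianPDFReal]
  rw [← ENNReal.ofReal_mul (by positivity), mul_assoc _ (Real.exp _), ← Real.exp_add, hc]
  congr 3
  field_simp
  ring

instance isProbabilityMeasure_complexGaussian (v : ℝ) : IsProbabilityMeasure (complexGaussian v) :=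
  Measure.isProbabilityMeasure_map (by fun_prop)

/-- The likelihood ratio `p (z - c) / p z` of the density `p` of `𝒞𝒩(0, v)`. -/
def gaussianRatio (v : ℝ) (c z : ℂ) : ℝ :=
  Real.exp ((2 * (c.re * z.re + c.im * z.im) - ‖c‖ ^ 2) / v)

@[fun_prop]
lemma measurable_gaussianRatio {X : Type*} [MeasurableSpace X] (v : ℝ) {f g : X → ℂ}
    (hf : Measurable f) (hg : Measurable g) :
    Measurable fun x => gaussianRatio v (f x) (g x) := by
  simp only [gaussianRatio]
  fun_prop

lemma lintegral_complexGaussian_add {v : ℝ} (hv : 0 < v) (c : ℂ) {f : ℂ → ℝ≥0∞}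
    (hf : Measurable f) :
    ∫⁻ z, f (z + c) ∂complexGaussian v =
      ∫⁻ z, ENNReal.ofReal (gaussianRatio v c z) * f z ∂complexGaussian v := by
  have key : ((gaussianReal 0 (v / 2).toNNReal).prod (gaussianReal 0 (v / 2).toNNReal)).map
      (Prod.map (· + c.re) (· + c.im)) =
      ((gaussianReal 0 (v / 2).toNNReal).prod (gaussianReal 0 (v / 2).toNNReal)).withDensity
      (fun p => ENNReal.ofReal (Real.exp ((2 * c.re * p.1 - c.re ^ 2) / v)) *
        ENNReal.ofReal (Real.exp ((2 * c.im * p.2 - c.im ^ 2) / v))) := by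
    rw [← Measure.map_prod_map _ _ (by fun_prop) (by fun_prop),
      gaussianReal_map_add_eq_withDensity hv, gaussianReal_map_add_eq_withDensity hv,
      prod_withDensity (by fun_prop) (by fun_prop)]
  rw [complexGaussian, lintegral_map (by fun_prop) (by fun_prop),
    lintegral_map (by fun_prop) (by fun_prop)]
  have h := congrArg (fun m => ∫⁻ p, f ((p.1 : ℂ) + p.2 * Complex.I) ∂m) key
  rw [lintegral_map (by fun_prop) (by fun_prop),
    lintegral_withDensity_eq_lintegral_mul _ (by fun_prop) (by fun_prop)] at h
  convert h using 4 with p p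
  · apply Complex.ext <;> simp
  · simp only [Pi.mul_apply]
    rw [← ENNReal.ofReal_mul (by positivity), ← Real.exp_add, gaussianRatio, Complex.sq_norm,
      Complex.normSq_apply]
    congr 3
    simp
    ring

lemma complexGaussian_map_add {v : ℝ} (hv : 0 < v) (c : ℂ) :
    (complexGaussian v).map (· + c) =
      (complexGaussian v).withDensity (fun z => ENNReal.ofReal (gaussianRatio v c z)) := by
  refine Measure.ext_of_lintegral _ fun f hf => ?_
  rw [lintegral_map hf (by fun_prop), lintegral_complexGaussian_add hv c hf,
    lintegral_withDensity_eq_lintegral_mul _ (by fun_prop) hf]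
  rfl

/-- The likelihood ratio for a shift `c` of a vector of independent `𝒞𝒩(0, v)` variables. -/
def vectorRatio {N : ℕ} (v : ℝ) (c w : Fin N → ℂ) : ℝ := ∏ i, gaussianRatio v (c i) (w i)

lemma vectorRatio_nonneg {N : ℕ} (v : ℝ) (c w : Fin N → ℂ) : 0 ≤ vectorRatio v c w :=
  Finset.prod_nonneg fun _ _ => (Real.exp_pos _).le

@[fun_prop]
lemma measurable_vectorRatio {X : Type*} [MeasurableSpace X] {N : ℕ} (v : ℝ)
    {f g : X → Fin N → ℂ} (hf : Measurable f) (hg : Measurable g) :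
    Measurable fun x => vectorRatio v (f x) (g x) := by
  simp only [vectorRatio, gaussianRatio]
  fun_prop

/-- The squared ratio is again a ratio, for the doubled shift, up to a factor free of `w`. Since
ratios integrate to one, that factor is the second moment. -/
lemma vectorRatio_sq {N : ℕ} (v : ℝ) (c w : Fin N → ℂ) :
    vectorRatio v c w ^ 2 =
      Real.exp (2 * (∑ i, ‖c i‖ ^ 2) / v) * vectorRatio v (fun i => 2 * c i) w := by
  simp only [vectorRatio, gaussianRatio, ← Real.exp_sum, ← Real.exp_nat_mul, ← Real.exp_add]
  congr 1
  rw [Finset.mul_sum, Finset.mul_sum, Finset.sum_div, ← Finset.sum_add_distrib]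
  refine Finset.sum_congr rfl fun i _ => ?_
  simp only [norm_mul, Complex.norm_ofNat, Complex.mul_re, Complex.mul_im, Complex.re_ofNat,
    Complex.im_ofNat, Nat.cast_ofNat]
  ring

/-- The law of the noise vector. -/
def noiseLaw (N : ℕ) (v : ℝ) : Measure (Fin N → ℂ) := Measure.pi fun _ => complexGaussian v

instance isProbabilityMeasure_noiseLaw (N : ℕ) (v : ℝ) : IsProbabilityMeasure (noiseLaw N v) := by
  unfold noiseLaw; infer_instance

lemma noiseLaw_map_add {N : ℕ} {v : ℝ} (hv : 0 < v) (c : Fin N → ℂ) :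
    (noiseLaw N v).map (· + c) =
      (noiseLaw N v).withDensity (fun w => ENNReal.ofReal (vectorRatio v c w)) := by
  have hm (i : Fin N) : Measurable (gaussianRatio v (c i)) :=
    measurable_gaussianRatio v measurable_const measurable_id
  have hp (i : Fin N) : IsProbabilityMeasure
      ((complexGaussian v).withDensity (fun z => ENNReal.ofReal (gaussianRatio v (c i) z))) := by
    rw [← complexGaussian_map_add hv]
    exact Measure.isProbabilityMeasure_map (by fun_prop)
  have hp' (i : Fin N) : SigmaFinite ((complexGaussian v).map (· + c i)) :=
    have := Measure.isProbabilityMeasure_map (μ := complexGaussian v) (f := (· + c i)) (by fun_prop)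
    inferInstance
  have h1 : (noiseLaw N v).map (· + c) = Measure.pi fun i => (complexGaussian v).map (· + c i) :=
    Measure.pi_map_pi (f := fun i z => z + c i) fun i => by fun_prop
  rw [h1]
  simp_rw [complexGaussian_map_add hv]
  rw [pi_withDensity _ _ fun i => (hm i).ennreal_ofReal, noiseLaw]
  congr 1
  funext w
  exact (ENNReal.ofReal_prod_of_nonneg fun i _ => (Real.exp_pos _).le).symm

lemma lintegral_vectorRatio {N : ℕ} {v : ℝ} (hv : 0 < v) (c : Fin N → ℂ) :
    ∫⁻ w, ENNReal.ofReal (vectorRatio v c w) ∂noiseLaw N v = 1 := by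
  have h := congrArg (fun m : Measure (Fin N → ℂ) => m Set.univ) (noiseLaw_map_add hv c)
  simp only [withDensity_apply _ MeasurableSet.univ, Measure.restrict_univ] at h
  rw [← h, Measure.map_apply (by fun_prop) MeasurableSet.univ]
  simp

/-! ### Noise translated by a vector that depends on the symbols. -/

section Shift

variable {U : Type*} [MeasurableSpace U] {N : ℕ} {v : ℝ}

lemma measurable_vectorRatio_comp {c : U → Fin N → ℂ} (hc : Measurable c) :
    Measurable fun p : U × (Fin N → ℂ) => vectorRatio v (c p.1) p.2 :=
  measurable_vectorRatio v (hc.comp measurable_fst) measurable_snd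

lemma lintegral_noiseLaw_add (hv : 0 < v) (c : Fin N → ℂ) {f : (Fin N → ℂ) → ℝ≥0∞}
    (hf : Measurable f) :
    ∫⁻ w, f (w + c) ∂noiseLaw N v =
      ∫⁻ w, ENNReal.ofReal (vectorRatio v c w) * f w ∂noiseLaw N v := by
  have hm : Measurable (vectorRatio v c) :=
    measurable_vectorRatio v measurable_const measurable_id
  rw [← lintegral_map hf (measurable_add_const c), noiseLaw_map_add hv,
    lintegral_withDensity_eq_lintegral_mul _ hm.ennreal_ofReal hf]
  rfl

lemma prod_noiseLaw_map_shift (ρ : Measure U) [IsProbabilityMeasure ρ] (hv : 0 < v)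
    {c : U → Fin N → ℂ} (hc : Measurable c) :
    (ρ.prod (noiseLaw N v)).map (fun p => (p.1, p.2 + c p.1)) =
      (ρ.prod (noiseLaw N v)).withDensity
        (fun p => ENNReal.ofReal (vectorRatio v (c p.1) p.2)) := by
  have hm := (measurable_vectorRatio_comp (v := v) hc).ennreal_ofReal
  have hs : Measurable fun p : U × (Fin N → ℂ) => (p.1, p.2 + c p.1) :=
    measurable_fst.prodMk (measurable_snd.add (hc.comp measurable_fst))
  refine Measure.ext_of_lintegral _ fun f hf => ?_
  rw [lintegral_map hf hs, lintegral_withDensity_eq_lintegral_mul _ hm hf,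
    lintegral_prod (fun p : U × (Fin N → ℂ) => f (p.1, p.2 + c p.1)) (hf.comp hs).aemeasurable,
    lintegral_prod _ (hm.mul hf).aemeasurable]
  exact lintegral_congr fun u => lintegral_noiseLaw_add hv (c u) (hf.comp measurable_prodMk_left)

lemma lintegral_vectorRatio_sq (ρ : Measure U) [IsProbabilityMeasure ρ] (hv : 0 < v)
    {c : U → Fin N → ℂ} (hc : Measurable c) :
    ∫⁻ p, ENNReal.ofReal (vectorRatio v (c p.1) p.2 ^ 2) ∂(ρ.prod (noiseLaw N v)) =
      ∫⁻ u, ENNReal.ofReal (Real.exp (2 * (∑ i, ‖c u i‖ ^ 2) / v)) ∂ρ := by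
  rw [lintegral_prod _ ((measurable_vectorRatio_comp hc).pow_const 2).ennreal_ofReal.aemeasurable]
  refine lintegral_congr fun u => ?_
  have hm : Measurable (vectorRatio v fun i => 2 * c u i) :=
    measurable_vectorRatio v measurable_const measurable_id
  simp_rw [vectorRatio_sq, ENNReal.ofReal_mul (Real.exp_pos _).le]
  rw [lintegral_const_mul _ hm.ennreal_ofReal, lintegral_vectorRatio hv, mul_one]

end Shift

/-! ### Information inequalities. -/

/-- The Hammersley–Chapman–Robbins inequality, in linearised form. -/
lemma two_mul_sub_le_integral_sq {X : Type*} [MeasurableSpace X] {M : Measure X}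
    [IsProbabilityMeasure M] {T L : X → ℝ} {m a : ℝ} (hT : MemLp T 2 M) (hL : MemLp L 2 M)
    (hT1 : ∫ x, T x ∂M = m) (hL1 : ∫ x, L x ∂M = 1) (hTL : ∫ x, L x * T x ∂M = m + a) (r : ℝ) :
    2 * r * a - r ^ 2 * (∫ x, L x ^ 2 ∂M - 1) ≤ ∫ x, (T x - m) ^ 2 ∂M := by
  have iT := hT.integrable one_le_two
  have iL := hL.integrable one_le_two
  have iTL : Integrable (fun x => L x * T x) M := hL.integrable_mul hT
  have iL2 := hL.integrable_sq
  have iS : Integrable (fun x => (T x - m) ^ 2) M := (hT.sub (memLp_const m)).integrable_sq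
  -- Expanding this square replaces Cauchy–Schwarz; the free multiplier `r` avoids dividing by the
  -- variance of `L`.
  have h0 : 0 ≤ ∫ x, (T x - m - r * (L x - 1)) ^ 2 ∂M := integral_nonneg fun x => sq_nonneg _
  have e (x : X) : (T x - m - r * (L x - 1)) ^ 2 = (T x - m) ^ 2 +
      ((-2 * r) * (L x * T x) + ((2 * r * m - 2 * r ^ 2) * L x + ((2 * r) * T x +
        (r ^ 2 * L x ^ 2 + (r ^ 2 - 2 * r * m))))) := by ring
  simp_rw [e] at h0
  rw [integral_add iS (by fun_prop), integral_add (by fun_prop) (by fun_prop),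
    integral_add (by fun_prop) (by fun_prop), integral_add (by fun_prop) (by fun_prop),
    integral_add (by fun_prop) (by fun_prop), integral_const_mul, integral_const_mul,
    integral_const_mul, integral_const_mul, hTL, hL1, hT1] at h0
  simp only [integral_const, probReal_univ, smul_eq_mul] at h0
  linarith

section Limit

variable {U : Type*} [MeasurableSpace U] {N : ℕ} {v : ℝ} {ρ : Measure U} [IsProbabilityMeasure ρ]

lemma memLp_vectorRatio (hv : 0 < v) {c : U → Fin N → ℂ} (hc : Measurable c) {K : ℝ}
    (hK : ∀ᵐ u ∂ρ, ∑ i, ‖c u i‖ ^ 2 ≤ K) :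
    MemLp (fun p : U × (Fin N → ℂ) => vectorRatio v (c p.1) p.2) 2 (ρ.prod (noiseLaw N v)) := by
  have hm := measurable_vectorRatio_comp (v := v) hc
  rw [memLp_two_iff_integrable_sq hm.aestronglyMeasurable]
  refine ⟨(hm.pow_const 2).aestronglyMeasurable, ?_⟩
  rw [hasFiniteIntegral_iff_ofReal (.of_forall fun _ => sq_nonneg _),
    lintegral_vectorRatio_sq ρ hv hc]
  have h : ∫⁻ u, ENNReal.ofReal (Real.exp (2 * (∑ i, ‖c u i‖ ^ 2) / v)) ∂ρ ≤
      ∫⁻ _, ENNReal.ofReal (Real.exp (2 * K / v)) ∂ρ := by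
    refine lintegral_mono_ae (hK.mono fun u hu => ?_)
    gcongr
  exact h.trans_lt (by simp)

lemma integral_vectorRatio_sq (hv : 0 < v) {c : U → Fin N → ℂ} (hc : Measurable c) :
    ∫ p, vectorRatio v (c p.1) p.2 ^ 2 ∂(ρ.prod (noiseLaw N v)) =
      ∫ u, Real.exp (2 * (∑ i, ‖c u i‖ ^ 2) / v) ∂ρ := by
  rw [integral_eq_lintegral_of_nonneg_ae (.of_forall fun _ => sq_nonneg _)
      ((measurable_vectorRatio_comp hc).pow_const 2).aestronglyMeasurable,
    lintegral_vectorRatio_sq ρ hv hc,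
    integral_eq_lintegral_of_nonneg_ae (.of_forall fun _ => (Real.exp_pos _).le) (by fun_prop)]

lemma integral_vectorRatio_mul (hv : 0 < v) {c : U → Fin N → ℂ} (hc : Measurable c)
    {T : U × (Fin N → ℂ) → ℝ} (hT : Measurable T) :
    ∫ p, vectorRatio v (c p.1) p.2 * T p ∂(ρ.prod (noiseLaw N v)) =
      ∫ p, T (p.1, p.2 + c p.1) ∂(ρ.prod (noiseLaw N v)) := by
  rw [← integral_map (f := T) (φ := fun p : U × (Fin N → ℂ) => (p.1, p.2 + c p.1)) (by fun_prop)
    (by fun_prop), prod_noiseLaw_map_shift ρ hv hc,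
    integral_withDensity_eq_integral_toReal_smul (by fun_prop) (by simp)]
  simp [ENNReal.toReal_ofReal (vectorRatio_nonneg _ _ _)]

/-- Integrates `exp x ≤ 1 + x + x ^ 2` for `0 ≤ x ≤ 1`. With `s` of order `t ^ 2`, the error is of
order `t ^ 4`. -/
lemma integral_exp_le {Q : U → ℝ} (hQ : Measurable Q) (hQ0 : ∀ u, 0 ≤ Q u) {K : ℝ}
    (hK : ∀ᵐ u ∂ρ, Q u ≤ K) {s : ℝ} (hs : 0 ≤ s) (hsK : s * K ≤ 1) :
    ∫ u, Real.exp (s * Q u) ∂ρ - 1 ≤ s * ∫ u, Q u ∂ρ + (s * K) ^ 2 := by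
  have iQ : Integrable Q ρ := by
    refine Integrable.of_bound (by fun_prop) K (hK.mono fun u hu => ?_)
    rwa [Real.norm_of_nonneg (hQ0 u)]
  have h : ∫ u, Real.exp (s * Q u) ∂ρ ≤ ∫ u, (1 + (s * Q u + (s * K) ^ 2)) ∂ρ := by
    refine integral_mono_of_nonneg (.of_forall fun _ => (Real.exp_pos _).le) (by fun_prop)
      (hK.mono fun u hu => ?_)
    have h1 : s * Q u ≤ s * K := by gcongr
    have h0 : 0 ≤ s * Q u := mul_nonneg hs (hQ0 u)
    have h2 := Real.abs_exp_sub_one_sub_id_le (x := s * Q u) (by rw [abs_of_nonneg h0]; linarith)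
    have h3 : (s * Q u) ^ 2 ≤ (s * K) ^ 2 := by gcongr
    have := (abs_le.1 h2).2
    show Real.exp (s * Q u) ≤ 1 + (s * Q u + (s * K) ^ 2)
    linarith
  rw [integral_add (by fun_prop) (by fun_prop), integral_add (by fun_prop) (by fun_prop),
    integral_const_mul] at h
  simp only [integral_const, probReal_univ, smul_eq_mul, one_mul] at h
  linarith

/-- A Cramér–Rao inequality in linearised form: if the mean of `T` grows linearly with slope `a`
when the noise is translated by `t • c`, its mean square deviation is bounded below. -/
lemma two_mul_sub_fisher_le (hv : 0 < v) {c : U → Fin N → ℂ} (hc : Measurable c) {K : ℝ}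
    (hK : ∀ᵐ u ∂ρ, ∑ i, ‖c u i‖ ^ 2 ≤ K) {T : U × (Fin N → ℂ) → ℝ} (hT : Measurable T)
    (hT2 : MemLp T 2 (ρ.prod (noiseLaw N v))) {m a : ℝ}
    (hmean : ∀ t : ℝ, ∫ p, T (p.1, p.2 + fun i => (t : ℂ) * c p.1 i) ∂(ρ.prod (noiseLaw N v)) =
      m + t * a) (r : ℝ) :
    2 * r * a - r ^ 2 * (2 / v * ∫ u, ∑ i, ‖c u i‖ ^ 2 ∂ρ) ≤
      ∫ p, (T p - m) ^ 2 ∂(ρ.prod (noiseLaw N v)) := by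
  have hK0 : 0 ≤ K := by
    obtain ⟨u, hu⟩ := hK.exists
    exact (Finset.sum_nonneg fun i _ => sq_nonneg _).trans hu
  set I := ∫ u, ∑ i, ‖c u i‖ ^ 2 ∂ρ
  have hm0 : ∫ p, T p ∂(ρ.prod (noiseLaw N v)) = m := by
    have h := hmean 0
    have e (p : U × (Fin N → ℂ)) : (p.1, p.2 + fun i => ((0 : ℝ) : ℂ) * c p.1 i) = p := by
      ext <;> simp
    simpa only [e, zero_mul, add_zero] using h
  have key : ∀ t : ℝ, 0 < t → 2 / v * t ^ 2 * K ≤ 1 →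
      2 * r * a - r ^ 2 * (2 / v * I) - r ^ 2 * (2 / v * K) ^ 2 * t ^ 2 ≤
        ∫ p, (T p - m) ^ 2 ∂(ρ.prod (noiseLaw N v)) := by
    intro t ht htK
    have hct : Measurable fun u => fun i => (t : ℂ) * c u i := by fun_prop
    have hsum (u : U) : ∑ i, ‖(t : ℂ) * c u i‖ ^ 2 = t ^ 2 * ∑ i, ‖c u i‖ ^ 2 := by
      rw [Finset.mul_sum]
      exact Finset.sum_congr rfl fun i _ => by simp [mul_pow]
    have hKt : ∀ᵐ u ∂ρ, ∑ i, ‖(t : ℂ) * c u i‖ ^ 2 ≤ t ^ 2 * K :=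
      hK.mono fun u hu => by rw [hsum]; gcongr
    have hTL := (integral_vectorRatio_mul (ρ := ρ) hv hct hT).trans (hmean t)
    have hL1 := integral_vectorRatio_mul (ρ := ρ) hv hct (T := fun _ => 1) measurable_const
    simp only [mul_one, integral_const, probReal_univ, smul_eq_mul] at hL1
    -- The mean moves by `t * a` and the variance of the ratio is of order `t ^ 2`, so the
    -- multiplier `r / t` keeps both terms of order one.
    have h := two_mul_sub_le_integral_sq hT2 (memLp_vectorRatio hv hct hKt) hm0 hL1 hTL (r / t)
    rw [integral_vectorRatio_sq hv hct] at h
    have hle := integral_exp_le (ρ := ρ) (Q := fun u => ∑ i, ‖c u i‖ ^ 2) (by fun_prop)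
      (fun u => Finset.sum_nonneg fun i _ => sq_nonneg _) hK (s := 2 / v * t ^ 2) (by positivity) htK
    have e (u : U) : 2 * (∑ i, ‖(t : ℂ) * c u i‖ ^ 2) / v = 2 / v * t ^ 2 * ∑ i, ‖c u i‖ ^ 2 := by
      rw [hsum]; ring
    simp_rw [e] at h
    have h3 : (r / t) ^ 2 * (∫ u, Real.exp (2 / v * t ^ 2 * ∑ i, ‖c u i‖ ^ 2) ∂ρ - 1) ≤
        (r / t) ^ 2 * (2 / v * t ^ 2 * I + (2 / v * t ^ 2 * K) ^ 2) := by gcongr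
    have e1 : 2 * (r / t) * (t * a) = 2 * r * a := by field_simp
    have e2 : (r / t) ^ 2 * (2 / v * t ^ 2 * I + (2 / v * t ^ 2 * K) ^ 2) =
      r ^ 2 * (2 / v * I) + r ^ 2 * (2 / v * K) ^ 2 * t ^ 2 := by field_simp
    linarith
  have lim : Filter.Tendsto
      (fun t : ℝ => 2 * r * a - r ^ 2 * (2 / v * I) - r ^ 2 * (2 / v * K) ^ 2 * t ^ 2)
      (nhdsWithin 0 (Set.Ioi 0)) (nhds (2 * r * a - r ^ 2 * (2 / v * I))) := by
    have : Continuous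
      (fun t : ℝ => 2 * r * a - r ^ 2 * (2 / v * I) - r ^ 2 * (2 / v * K) ^ 2 * t ^ 2) := by fun_prop
    simpa using (this.tendsto 0).mono_left nhdsWithin_le_nhds
  have small : ∀ᶠ t : ℝ in nhdsWithin 0 (Set.Ioi 0), 2 / v * t ^ 2 * K < 1 := by
    have : Continuous fun t : ℝ => 2 / v * t ^ 2 * K := by fun_prop
    exact ((this.tendsto 0).mono_left nhdsWithin_le_nhds).eventually_lt_const (by simp)
  refine le_of_tendsto lim ?_
  filter_upwards [small, self_mem_nhdsWithin] with t h1 h2 using key t h2 h1.le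

end Limit

/-! ### Moments of the shifted constellation. -/

lemma integral_uniformOn_finset (B : Finset ℂ) (f : ℂ → ℝ) :
    ∫ z, f z ∂uniformOn (B : Set ℂ) = (∑ z ∈ B, f z) / B.card := by
  have hB : IntegrableOn f (B : Set ℂ) Measure.count := by
    rw [← (B : Set ℂ).biUnion_of_singleton]
    simp [integrableOn_finset_iUnion]
  rw [uniformOn, ProbabilityTheory.cond, integral_smul_measure, setIntegral_finset _ hB]
  simp [Measure.real, div_eq_inv_mul]

section Moments

variable (A : Finset ℂ) (s : ℝ)

lemma sum_shifted (f : ℂ → ℝ) : ∑ z ∈ shifted A s, f z = ∑ x ∈ A, f (x + s) :=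
  Finset.sum_image fun _ _ _ _ h => add_right_cancel h

lemma card_shifted : (shifted A s).card = A.card :=
  Finset.card_image_of_injective _ fun _ _ h => add_right_cancel h

variable {A}

lemma integral_re_shifted (h0 : A.Nonempty) (hA : ∑ x ∈ A, x = 0) :
    ∫ z, z.re ∂uniformOn (shifted A s : Set ℂ) = s := by
  have hc : (A.card : ℝ) ≠ 0 := by simpa using h0.ne_empty
  have h := congrArg Complex.re hA
  rw [Complex.re_sum] at h
  rw [integral_uniformOn_finset, sum_shifted, card_shifted]
  simp only [Complex.add_re, Complex.ofReal_re, Finset.sum_add_distrib, h, Finset.sum_const]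
  simp [hc]

lemma integral_im_shifted (hA : ∑ x ∈ A, x = 0) :
    ∫ z, z.im ∂uniformOn (shifted A s : Set ℂ) = 0 := by
  have h := congrArg Complex.im hA
  rw [Complex.im_sum] at h
  rw [integral_uniformOn_finset, sum_shifted]
  simp [h]

lemma integral_norm_sq_shifted (h0 : A.Nonempty) (hA : ∑ x ∈ A, x = 0) :
    ∫ z, ‖z‖ ^ 2 ∂uniformOn (shifted A s : Set ℂ) = avgEnergy A + s ^ 2 := by
  have hc : (A.card : ℝ) ≠ 0 := by simpa using h0.ne_empty
  have h := congrArg Complex.re hA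
  rw [Complex.re_sum, Complex.zero_re] at h
  have e (x : ℂ) : ‖x + s‖ ^ 2 = ‖x‖ ^ 2 + (2 * s * x.re + s ^ 2) := by
    simp only [Complex.sq_norm, Complex.normSq_apply, Complex.add_re, Complex.add_im,
      Complex.ofReal_re, Complex.ofReal_im]
    ring
  rw [integral_uniformOn_finset, sum_shifted, card_shifted, avgEnergy]
  simp only [e, Finset.sum_add_distrib, ← Finset.mul_sum, h, Finset.sum_const, nsmul_eq_mul]
  field_simp
  ring

end Moments

/-! ### Joint law of symbols and noise, and the information along a direction. -/

namespace IsFrame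

variable {Ω : Type*} [MeasurableSpace Ω] {P : Measure Ω} {N : ℕ}
  {B : Finset ℂ} {σ : ℝ} {Xa Xb W : Fin N → Ω → ℂ}

lemma ae_norm_le {X : Ω → ℂ} (hX : HasLaw X (uniformOn (B : Set ℂ)) P) :
    ∀ᵐ ω ∂P, ‖X ω‖ ≤ ∑ z ∈ B, ‖z‖ := by
  have h : ∀ᵐ z ∂uniformOn (B : Set ℂ), ‖z‖ ≤ ∑ z ∈ B, ‖z‖ := by
    have h1 : ∀ᵐ z ∂uniformOn (B : Set ℂ), z ∈ (B : Set ℂ) :=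
      ae_cond_mem B.measurableSet
    exact h1.mono fun z hz => Finset.single_le_sum (f := fun z : ℂ => ‖z‖) (fun _ _ => norm_nonneg _) hz
  rw [← hX.map_eq] at h
  exact ae_of_ae_map hX.aemeasurable h

lemma memLp_two_comp [IsProbabilityMeasure P] {X : Ω → ℂ} (hX : HasLaw X (uniformOn (B : Set ℂ)) P) {f : ℂ → ℝ}
    (hf : ∀ z, |f z| ≤ ‖z‖) (hc : Continuous f) : MemLp (fun ω => f (X ω)) 2 P := by
  refine MemLp.of_bound (hc.measurable.comp_aemeasurable hX.aemeasurable).aestronglyMeasurable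
    (∑ z ∈ B, ‖z‖) ((ae_norm_le hX).mono fun ω h => ?_)
  exact (hf _).trans h

lemma indepFun_symbols_noise (h : IsFrame P B σ Xa Xb W) :
    IndepFun (fun ω => ((fun i => Xa i ω, fun i => Xb i ω) : (Fin N → ℂ) × (Fin N → ℂ)))
      (fun ω i => W i ω) P := by
  let S : Finset (Fin N ⊕ (Fin N ⊕ Fin N)) := Finset.univ.disjSum (Finset.univ.disjSum ∅)
  let T : Finset (Fin N ⊕ (Fin N ⊕ Fin N)) :=
    Finset.disjSum ∅ (Finset.disjSum ∅ Finset.univ)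
  have hST : Disjoint S T := by
    rw [Finset.disjoint_left]
    rintro (i | i | i) <;> simp [S, T]
  have hm : ∀ j, AEMeasurable (Sum.elim Xa (Sum.elim Xb W) j) P := by
    rintro (i | i | i)
    · exact (h.law_Xa i).aemeasurable
    · exact (h.law_Xb i).aemeasurable
    · exact (h.law_W i).aemeasurable
  have ha (i : Fin N) : Sum.inl i ∈ S := by simp [S]
  have hb (i : Fin N) : Sum.inr (Sum.inl i) ∈ S := by simp [S]
  have hw (i : Fin N) : Sum.inr (Sum.inr i) ∈ T := by simp [T]
  exact (h.indep.indepFun_finset₀ S T hST hm).comp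
    (φ := fun g => ((fun i => g ⟨_, ha i⟩, fun i => g ⟨_, hb i⟩) : (Fin N → ℂ) × (Fin N → ℂ)))
    (ψ := fun g i => g ⟨_, hw i⟩) (by fun_prop) (by fun_prop)

/-- The joint law of the symbols of the two nodes. -/
def _root_.FullDuplex.symbolLaw (P : Measure Ω) (Xa Xb : Fin N → Ω → ℂ) :
    Measure ((Fin N → ℂ) × (Fin N → ℂ)) :=
  P.map fun ω => (fun i => Xa i ω, fun i => Xb i ω)

lemma aemeasurable_symbols (h : IsFrame P B σ Xa Xb W) :
    AEMeasurable
      (fun ω => ((fun i => Xa i ω, fun i => Xb i ω) : (Fin N → ℂ) × (Fin N → ℂ))) P :=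
  (aemeasurable_pi_lambda _ fun i => (h.law_Xa i).aemeasurable).prodMk
    (aemeasurable_pi_lambda _ fun i => (h.law_Xb i).aemeasurable)

lemma aemeasurable_noise (h : IsFrame P B σ Xa Xb W) : AEMeasurable (fun ω i => W i ω) P :=
  aemeasurable_pi_lambda _ fun i => (h.law_W i).aemeasurable

lemma map_eq_prod [IsProbabilityMeasure P] (h : IsFrame P B σ Xa Xb W) :
    P.map (fun ω => (((fun i => Xa i ω, fun i => Xb i ω) : (Fin N → ℂ) × (Fin N → ℂ)),
      fun i => W i ω)) = (symbolLaw P Xa Xb).prod (noiseLaw N (σ ^ 2)) := by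
  rw [(indepFun_iff_map_prod_eq_prod_map_map h.aemeasurable_symbols h.aemeasurable_noise).1
    h.indepFun_symbols_noise]
  congr 1
  have hW : iIndepFun W P := h.indep.precomp (g := fun i => Sum.inr (Sum.inr i))
    (Sum.inr_injective.comp Sum.inr_injective)
  rw [hW.map_fun_eq_pi_map fun i => (h.law_W i).aemeasurable, noiseLaw]
  congr 1
  funext i
  exact (h.law_W i).map_eq

lemma isProbabilityMeasure_symbolLaw [IsProbabilityMeasure P] (h : IsFrame P B σ Xa Xb W) :
    IsProbabilityMeasure (symbolLaw P Xa Xb) :=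
  Measure.isProbabilityMeasure_map h.aemeasurable_symbols

/-- The quadratic form of the information matrix. By independence the cross term is the squared mean
`s ^ 2` of a shifted symbol. -/
lemma integral_norm_sq_combination [IsProbabilityMeasure P] {A : Finset ℂ} {s : ℝ} (h0 : A.Nonempty)
    (hA : ∑ x ∈ A, x = 0) (h : IsFrame P (shifted A s) σ Xa Xb W) (p q : ℝ) :
    ∫ u, ∑ i, ‖(p : ℂ) * u.1 i + q * u.2 i‖ ^ 2 ∂symbolLaw P Xa Xb =
      N * ((p ^ 2 + q ^ 2) * (avgEnergy A + s ^ 2) + 2 * p * q * s ^ 2) := by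
  have e (x y : ℂ) : ‖(p : ℂ) * x + q * y‖ ^ 2 =
      p ^ 2 * ‖x‖ ^ 2 + (q ^ 2 * ‖y‖ ^ 2 + (2 * p * q * (x.re * y.re) +
        2 * p * q * (x.im * y.im))) := by
    simp only [Complex.sq_norm, Complex.normSq_apply, Complex.add_re, Complex.add_im,
      Complex.mul_re, Complex.mul_im, Complex.ofReal_re, Complex.ofReal_im]
    ring
  rw [symbolLaw, integral_map h.aemeasurable_symbols (by fun_prop)]
  have na (i : Fin N) := memLp_two_comp (h.law_Xa i) (f := fun z => ‖z‖)
    (fun z => by simp) continuous_norm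
  have nb (i : Fin N) := memLp_two_comp (h.law_Xb i) (f := fun z => ‖z‖)
    (fun z => by simp) continuous_norm
  have ra (i : Fin N) := memLp_two_comp (h.law_Xa i) Complex.abs_re_le_norm
    Complex.continuous_re
  have rb (i : Fin N) := memLp_two_comp (h.law_Xb i) Complex.abs_re_le_norm
    Complex.continuous_re
  have ia (i : Fin N) := memLp_two_comp (h.law_Xa i) Complex.abs_im_le_norm
    Complex.continuous_im
  have ib (i : Fin N) := memLp_two_comp (h.law_Xb i) Complex.abs_im_le_norm
    Complex.continuous_im
  have i1 (i : Fin N) := (na i).integrable_sq.const_mul (p ^ 2)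
  have i2 (i : Fin N) := (nb i).integrable_sq.const_mul (q ^ 2)
  have i3 (i : Fin N) : Integrable (fun ω => 2 * p * q * ((Xa i ω).re * (Xb i ω).re)) P :=
    ((ra i).integrable_mul (rb i)).const_mul _
  have i4 (i : Fin N) : Integrable (fun ω => 2 * p * q * ((Xa i ω).im * (Xb i ω).im)) P :=
    ((ia i).integrable_mul (ib i)).const_mul _
  simp_rw [e]
  rw [integral_finsetSum Finset.univ fun i _ => by
    exact (i1 i).add ((i2 i).add ((i3 i).add (i4 i)))]
  rw [Finset.sum_congr rfl (g := fun _ => (p ^ 2 + q ^ 2) * (avgEnergy A + s ^ 2) +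
    2 * p * q * s ^ 2)]
  · rw [Finset.sum_const, Finset.card_univ, Fintype.card_fin, nsmul_eq_mul]
  intro i _
  have hind : IndepFun (Xa i) (Xb i) P :=
    h.indep.indepFun (i := Sum.inl i) (j := Sum.inr (Sum.inl i)) (by simp)
  have hre : ∫ ω, (Xa i ω).re * (Xb i ω).re ∂P = s * s := by
    have := (hind.comp Complex.measurable_re Complex.measurable_re).integral_fun_mul_eq_mul_integral
      (ra i).1 (rb i).1
    refine this.trans ?_
    rw [(h.law_Xa i).integral_comp (f := Complex.re) (by fun_prop),
      (h.law_Xb i).integral_comp (f := Complex.re) (by fun_prop), integral_re_shifted s h0 hA]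
  have him : ∫ ω, (Xa i ω).im * (Xb i ω).im ∂P = 0 := by
    have := (hind.comp Complex.measurable_im Complex.measurable_im).integral_fun_mul_eq_mul_integral
      (ia i).1 (ib i).1
    refine this.trans ?_
    rw [(h.law_Xa i).integral_comp (f := Complex.im) (by fun_prop), integral_im_shifted s hA,
      zero_mul]
  have hna : ∫ ω, ‖Xa i ω‖ ^ 2 ∂P = avgEnergy A + s ^ 2 :=
    ((h.law_Xa i).integral_comp (f := fun z => ‖z‖ ^ 2) (by fun_prop)).trans
      (integral_norm_sq_shifted s h0 hA)
  have hnb : ∫ ω, ‖Xb i ω‖ ^ 2 ∂P = avgEnergy A + s ^ 2 :=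
    ((h.law_Xb i).integral_comp (f := fun z => ‖z‖ ^ 2) (by fun_prop)).trans
      (integral_norm_sq_shifted s h0 hA)
  rw [integral_add (i1 i) (by exact (i2 i).add ((i3 i).add (i4 i))),
    integral_add (i2 i) (by exact (i3 i).add (i4 i)), integral_add (i3 i) (i4 i), integral_const_mul,
    integral_const_mul, integral_const_mul, integral_const_mul, hre, him, hna, hnb]
  ring

/-- Symbols from a finite constellation are bounded, which keeps the exponential moments in the
information inequality finite. -/
lemma ae_norm_sq_combination_le (h : IsFrame P B σ Xa Xb W) (p q : ℝ) :
    ∃ K : ℝ, ∀ᵐ u ∂symbolLaw P Xa Xb, ∑ i, ‖(p : ℂ) * u.1 i + q * u.2 i‖ ^ 2 ≤ K := by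
  refine ⟨∑ _i : Fin N, (|p| * ∑ z ∈ B, ‖z‖ + |q| * ∑ z ∈ B, ‖z‖) ^ 2, ?_⟩
  rw [symbolLaw, ae_map_iff h.aemeasurable_symbols (measurableSet_le (by fun_prop) (by fun_prop))]
  have ha := ae_all_iff.2 fun i => ae_norm_le (h.law_Xa i)
  have hb := ae_all_iff.2 fun i => ae_norm_le (h.law_Xb i)
  filter_upwards [ha, hb] with ω h1 h2
  refine Finset.sum_le_sum fun i _ => ?_
  have := norm_add_le ((p : ℂ) * Xa i ω) (q * Xb i ω)
  simp only [norm_mul, Complex.norm_real, Real.norm_eq_abs] at this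
  have h3 : |p| * ‖Xa i ω‖ ≤ |p| * ∑ z ∈ B, ‖z‖ := by gcongr; exact h1 i
  have h4 : |q| * ‖Xb i ω‖ ≤ |q| * ∑ z ∈ B, ‖z‖ := by gcongr; exact h2 i
  gcongr
  linarith

end IsFrame

/-- The least favourable direction for estimating the `l`-th parameter. -/
lemma exists_direction (β : ℝ) (l : Fin 4) :
    ∃ (η : ℂ) (p q : ℝ), ‖η‖ = 1 ∧ p ^ 2 + q ^ 2 = (1 + β) ^ 2 + β ^ 2 ∧ p * q = -(β * (1 + β)) ∧
      ∀ (t : ℝ) (haa hba : ℂ), param (haa + t * (η * p)) (hba + t * (η * q)) l =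
        param haa hba l + t * (1 + β) := by
  -- Up to scale, `(1 + β, -β)` and `(-β, 1 + β)` are the columns of the inverse of `[[1 + β, β],
  -- [β, 1 + β]]`; `η` selects the real or imaginary part.
  fin_cases l
  · exact ⟨1, 1 + β, -β, by simp, by ring, by ring, fun t haa hba => by simp [param]⟩
  · exact ⟨Complex.I, 1 + β, -β, by simp, by ring, by ring, fun t haa hba => by simp [param]⟩
  · exact ⟨1, -β, 1 + β, by simp, by ring, by ring, fun t haa hba => by simp [param]⟩
  · exact ⟨Complex.I, -β, 1 + β, by simp, by ring, by ring, fun t haa hba => by simp [param]⟩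

/-! ### The estimator as a function of symbols and noise. -/

section Main

variable {Ω : Type*} [MeasurableSpace Ω] {P : Measure Ω} {N : ℕ}
  {B : Finset ℂ} {σ : ℝ} {Xa Xb W : Fin N → Ω → ℂ}
  {est : (Fin N → ℂ) → (Fin N → ℂ) → Fin 4 → ℝ}

/-- The `l`-th component of an estimator, as a function of all symbols and the noise. -/
def statistic (est : (Fin N → ℂ) → (Fin N → ℂ) → Fin 4 → ℝ) (haa hba : ℂ) (l : Fin 4)
    (x : ((Fin N → ℂ) × (Fin N → ℂ)) × (Fin N → ℂ)) : ℝ :=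
  est x.1.1 (fun i => haa * x.1.1 i + hba * x.1.2 i + x.2 i) l

lemma measurable_statistic (hest : Measurable (Function.uncurry est)) (haa hba : ℂ) (l : Fin 4) :
    Measurable (statistic est haa hba l) := by
  have h : Measurable fun x : ((Fin N → ℂ) × (Fin N → ℂ)) × (Fin N → ℂ) =>
      (x.1.1, fun i => haa * x.1.1 i + hba * x.1.2 i + x.2 i) := by fun_prop
  exact (measurable_pi_apply l).comp (hest.comp h)

lemma IsFrame.aemeasurable_joint (h : IsFrame P B σ Xa Xb W) :
    AEMeasurable (fun ω => (((fun i => Xa i ω, fun i => Xb i ω) : (Fin N → ℂ) × (Fin N → ℂ)),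
      fun i => W i ω)) P :=
  h.aemeasurable_symbols.prodMk h.aemeasurable_noise

lemma IsFrame.memLp_statistic [IsProbabilityMeasure P] (h : IsFrame P B σ Xa Xb W)
    (hest : Measurable (Function.uncurry est)) {haa hba : ℂ} {l : Fin 4}
    (hfin : mse P est Xa Xb W haa hba l ≠ ⊤) :
    MemLp (statistic est haa hba l) 2 ((symbolLaw P Xa Xb).prod (noiseLaw N (σ ^ 2))) := by
  have hT := measurable_statistic hest haa hba l
  have hae : AEStronglyMeasurable (fun ω => estimate est Xa Xb W haa hba ω l) P :=
    (hT.comp_aemeasurable h.aemeasurable_joint).aestronglyMeasurable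
  rw [← h.map_eq_prod, memLp_map_measure_iff hT.aestronglyMeasurable h.aemeasurable_joint]
  have h2 : MemLp (fun ω => estimate est Xa Xb W haa hba ω l - param haa hba l) 2 P := by
    refine (memLp_two_iff_integrable_sq (hae.sub aestronglyMeasurable_const)).2 ?_
    refine ⟨(hae.sub aestronglyMeasurable_const).pow 2, ?_⟩
    rw [hasFiniteIntegral_iff_ofReal (.of_forall fun _ => sq_nonneg _)]
    simp only [mse, sq_abs] at hfin
    exact lt_top_iff_ne_top.2 hfin
  exact (h2.add (memLp_const (param haa hba l))).ae_eq
    (.of_forall fun ω => sub_add_cancel (estimate est Xa Xb W haa hba ω l) (param haa hba l))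

lemma IsFrame.integral_statistic_sub_sq [IsProbabilityMeasure P] (h : IsFrame P B σ Xa Xb W)
    (hest : Measurable (Function.uncurry est)) {haa hba : ℂ} {l : Fin 4} :
    ∫ x, (statistic est haa hba l x - param haa hba l) ^ 2
      ∂((symbolLaw P Xa Xb).prod (noiseLaw N (σ ^ 2))) =
      (mse P est Xa Xb W haa hba l).toReal := by
  have hT := measurable_statistic hest haa hba l
  have hae : AEStronglyMeasurable (fun ω => estimate est Xa Xb W haa hba ω l) P :=
    (hT.comp_aemeasurable h.aemeasurable_joint).aestronglyMeasurable
  rw [← h.map_eq_prod, integral_map h.aemeasurable_joint (by fun_prop), mse]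
  simp only [sq_abs]
  exact integral_eq_lintegral_of_nonneg_ae (.of_forall fun _ => sq_nonneg _)
    ((hae.sub aestronglyMeasurable_const).pow 2)

lemma IsFrame.integral_statistic_shift [IsProbabilityMeasure P] (h : IsFrame P B σ Xa Xb W)
    (hest : Measurable (Function.uncurry est)) (hunb : IsUnbiased P est Xa Xb W)
    (haa hba da db : ℂ) (l : Fin 4) (t : ℝ) :
    ∫ x, statistic est haa hba l (x.1, x.2 + fun i => (t : ℂ) * (da * x.1.1 i + db * x.1.2 i))
      ∂((symbolLaw P Xa Xb).prod (noiseLaw N (σ ^ 2))) =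
      param (haa + t * da) (hba + t * db) l := by
  have e (x : ((Fin N → ℂ) × (Fin N → ℂ)) × (Fin N → ℂ)) :
      statistic est haa hba l (x.1, x.2 + fun i => (t : ℂ) * (da * x.1.1 i + db * x.1.2 i)) =
        statistic est (haa + t * da) (hba + t * db) l x := by
    simp only [statistic, Pi.add_apply]
    congr 2
    funext i
    ring
  simp_rw [e]
  rw [← h.map_eq_prod, integral_map h.aemeasurable_joint
    (measurable_statistic hest _ _ l).aestronglyMeasurable]
  exact (hunb _ _ l).2

end Main

end FullDuplex

end

theorem proposition4 {Ω : Type*} [MeasurableSpace Ω] (P : Measure Ω) [IsProbabilityMeasure P]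
    (N : ℕ) (hN : 0 < N)
    (A : Finset ℂ) (hA : ∑ x ∈ A, x = 0)
    (E : ℝ) (hE : E = FullDuplex.avgEnergy A) (hEpos : 0 < E)
    (β σ : ℝ) (hβ : 0 < β) (hσ : 0 < σ)
    (Xa Xb W : Fin N → Ω → ℂ)
    (hframe : FullDuplex.IsFrame P (FullDuplex.shifted A (Real.sqrt (β * E))) σ Xa Xb W)
    (est : (Fin N → ℂ) → (Fin N → ℂ) → Fin 4 → ℝ)
    (hest : Measurable (Function.uncurry est))
    (hunbiased : FullDuplex.IsUnbiased P est Xa Xb W)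
    (haa hba : ℂ) (l : Fin 4) :
    ENNReal.ofReal (σ ^ 2 / (2 * N * E) * ((1 + β) / (1 + 2 * β)))
      ≤ FullDuplex.mse P est Xa Xb W haa hba l := by
  -- Otherwise the estimator is square integrable at the given gains; at other gains only its mean
  -- is used.
  by_cases hfin : FullDuplex.mse P est Xa Xb W haa hba l = ⊤
  · simp [hfin]
  have hA0 : A.Nonempty := by
    rw [Finset.nonempty_iff_ne_empty]
    rintro rfl
    -- The average energy of the empty set is `0 / 0 = 0`, contradicting `hEpos`.
    simp [FullDuplex.avgEnergy] at hE
    exact hEpos.ne' hE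
  have hs : Real.sqrt (β * E) ^ 2 = β * E := Real.sq_sqrt (by positivity)
  obtain ⟨η, p, q, hη, hpq, hpq', hparam⟩ := FullDuplex.exists_direction β l
  have := hframe.isProbabilityMeasure_symbolLaw
  obtain ⟨K, hK⟩ := hframe.ae_norm_sq_combination_le p q
  have hI := hframe.integral_norm_sq_combination hA0 hA p q
  rw [hs, ← hE] at hI
  have hnorm (u : (Fin N → ℂ) × (Fin N → ℂ)) (i : Fin N) :
      ‖η * p * u.1 i + η * q * u.2 i‖ = ‖(p : ℂ) * u.1 i + q * u.2 i‖ := by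
    rw [mul_assoc, mul_assoc, ← mul_add, norm_mul, hη, one_mul]
  have hmean := fun t : ℝ => (hframe.integral_statistic_shift hest hunbiased haa hba (η * p) (η * q)
    l t).trans (hparam t haa hba)
  have hN' : (0 : ℝ) < N := by exact_mod_cast hN
  have hσ2 : 0 < σ ^ 2 := by positivity
  have hc : Measurable fun (u : (Fin N → ℂ) × (Fin N → ℂ)) (i : Fin N) =>
      η * p * u.1 i + η * q * u.2 i := by fun_prop
  have hK' : ∀ᵐ u ∂FullDuplex.symbolLaw P Xa Xb,
      ∑ i, ‖η * p * u.1 i + η * q * u.2 i‖ ^ 2 ≤ K := by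
    simpa only [hnorm] using hK
  -- The multiplier is the maximiser `a / J` of `2 * r * a - r ^ 2 * J`, with slope `a = 1 + β` and
  -- information `J = 2 N E (1 + β) (1 + 2 β) / σ ^ 2`; the maximum `a ^ 2 / J` is the bound.
  have key := FullDuplex.two_mul_sub_fisher_le hσ2 hc hK'
    (FullDuplex.measurable_statistic hest haa hba l) (hframe.memLp_statistic hest hfin) hmean
    (σ ^ 2 / (2 * N * E * (1 + 2 * β)))
  simp only [hnorm] at key
  rw [hI, hframe.integral_statistic_sub_sq hest] at key
  rw [ENNReal.ofReal_le_iff_le_toReal hfin]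
  refine le_of_eq_of_le ?_ key
  have e : (N : ℝ) * ((p ^ 2 + q ^ 2) * (E + β * E) + 2 * p * q * (β * E)) =
      N * E * (1 + β) * (1 + 2 * β) := by
    rw [hpq, mul_assoc 2 p q, hpq']
    ring
  rw [e]
  field_simp
  ring
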